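/- **Setting.** A synchronous game $\mathcal G=(I,O,\lambda)$ with $I=\{1,\dots,n\}$, $O=\{1,\dots,m\}$, $m\ge 3$, has a rule function $\lambda:O\times O\times I\times I\to\{0,1\}$ with $\lambda(a,b,x,x)=0$ whenever $a\ne b$. For a correlation $p=(p(a,b|x,y))$ and a prior distribution $\pi$ on $I\times I$ put $\omega(\mathcal G,\pi,p)=\sum_{x,y}\pi(x,y)\sum_{a,b}\lambda(a,b,x,y)p(a,b|x,y)$; $\pi_u(x,y)=1/n^2$ is the uniform prior. For a finite graph $G$, $\mathrm{Hom}(G,K_3)$ is the game with questions $V(G)$, answers $\{1,2,3\}$, and $\lambda(a,b,x,y)=0$ iff ($x=y$ and $a\neq b$) or ($x\sim y$ and $a=b$); its prior $\pi_{\mathrm{edges}}$ is $1/(2|E(G)|)$ on ordered pairs of adjacent vertices and $0$ elsewhere. *Models.* Let $t\in\{loc,q,qa,qc\}$. A tracial von Neumann algebra $(\mathcal M,\tau)$ ($\tau$ a faithful normal tracial state) is *of type $t$* if: $\mathcal M$ is abelian ($t=loc$); $\mathcal M$ is finite-dimensional ($t=q$); $(\mathcal M,\tau)$ is a tracial ultrapower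 $\mathcal R^{\mathcal U}$ of the hyperfinite $\mathrm{II}_1$ factor $\mathcal R$ by a free ultrafilter $\mathcal U$ on $\mathbb N$ ($t=qa$); no condition ($t=qc$). A correlation $p$ is *realized in* $(\mathcal M,\tau)$ if $p(a,b|x,y)=\tau(E_{a,x}E_{b,y})$ where, for each $x$, $\{E_{a,x}\}_{a}$ is a projection-valued measure in $\mathcal M$. The set $C_t^s(I,O)$ of synchronous $t$-correlations consists of those realized in some $(\mathcal M,\tau)$ of type $t$, and $\omega_t^s(\mathcal G,\pi)=\sup\{\omega(\mathcal G,\pi,p):p\in C^s_t(I,O)\}$. *The graph $G_\lambda$.* Take a triangle $\{A,B,C\}$; for $1\le\alpha\le m-2$, $1\le x\le n$ a copy $R_{\alpha,x}$ of $K_3\times K_3$ with vertices $v(i,j,\alpha,x)$, $1\le i,j\le 3$, where $(i,j)\sim(k,\ell)$ iff exactly one of $i=k$, $j=\ell$ holds; and a triangular prism $T_{\alpha,x}$ with triangles $\{s(j,\alpha,x)\}_{j=1}^{3}$, $\{t(j,\alpha,x)\}_{j=1}^{3}$ and edges $s(j,\alpha,x)\sim t(j,\alpha,x)$. Put $\widehat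 v(1,x)=v(1,1,1,x)$, $\widehat v(a,x)=v(2,1,a-1,x)$ for $2\le a\le m-1$, and $\widehat v(m,x)=v(2,2,m-2,x)$. Let $\mathcal E_\lambda$ (resp. $\mathcal F_\lambda$) be the set of $(a,b,x,y)\in\lambda^{-1}(\{0\})$ with $a,b\in\{1,m\}$ (resp. $2\le a,b\le m-1$), and for each $(a,b,x,y)\in\mathcal E_\lambda\cup\mathcal F_\lambda$ take a further copy $Q_{a,b,x,y}$ of $K_3\times K_3$ with vertices $q(i,j,a,b,x,y)$. Identify $v(1,2,\alpha,x)=B$; $v(3,2,\alpha,x)=v(1,1,\alpha+1,x)$ for $\alpha\le m-3$; $s(j,\alpha,x)=v(1,j,\alpha,x)$; $t(2,\alpha,x)=A$; $q(1,1,a,b,x,y)=\widehat v(a,x)$; $q(2,2,a,b,x,y)=\widehat v(b,y)$; and $q(1,2,a,b,x,y)=B$ on $\mathcal E_\lambda$, $=C$ on $\mathcal F_\lambda$. Finally add the edges $A\sim v(3,3,\alpha,x)$, $C\sim v(2,1,\alpha,x)$, $A\sim q(3,3,a,b,x,y)$, and $\widehat v(a,x)\sim\widehat v(b,y)$ for all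 $(a,b,x,y)\in\lambda^{-1}(\{0\})\setminus(\mathcal E_\lambda\cup\mathcal F_\lambda)$. **Theorem.** There is a polynomial $P$ in two variables such that for all $n$, all $m\ge3$, every synchronous game $\mathcal G$ with $n$ questions and $m$ answers, and every $t\in\{loc,q,qa,qc\}$ the following hold. 1. Let $(\mathcal M,\tau)$ be a tracial von Neumann algebra of type $t$ and let $p\in C_t^s(I,O)$ be realized in $(\mathcal M,\tau)$, with $\omega(\mathcal G,\pi_u,p)=1-\varepsilon$. Then there is a synchronous $t$-correlation $\widetilde p\in C_t^s(V(G_\lambda),\{1,2,3\})$, realized in the same $(\mathcal M,\tau)$, such that $$\omega(\mathrm{Hom}(G_\lambda,K_3),\pi_{\mathrm{edges}},\widetilde p)\ \ge\ 1-\frac{356n^2}{|E(G_\lambda)|}\,\varepsilon\ \ge\ 1-P(n,m)\,\varepsilon.$$ 2. If $\varepsilon\in\mathbb R$ and $\omega_t^s(\mathcal G,\pi_u)\ge1-\varepsilon$, then $\omega_t^s(\mathrm{Hom}(G_\lambda,K_3),\pi_{\mathrm{edges}})\ge 1-\frac{356n^2}{|E(G_\lambda)|}\varepsilon$ and $\omega_t^s(\mathrm{Hom}(G_\lambda,K_3),\pi_{\mathrm{edges}})\ge1-P(n,m)\,\varepsilon$.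 -/

import Mathlib

open scoped ComplexOrder

universe u

noncomputable section

namespace SyncGames

/-! ### Synchronous games, prior distributions, winning probability -/

/-- A synchronous non-local game with question set `I` and answer set `O`. The rule function
`λ(a,b,x,y) ∈ {0,1}` is given by the proposition `rule a b x y`, meaning `λ(a,b,x,y) = 1`. -/
structure SyncGame (I O : Type*) where
  rule : O → O → I → I → Prop
  sync : ∀ (x : I) (a b : O), a ≠ b → ¬ rule a b x x

/-- `p a b x y` stands for `p(a,b|x,y)`. -/
abbrev Correlation (I O : Type*) := O → O → I → I → ℝ

open Classical in
/-- `∑_{x,y} π(x,y) ∑_{a,b} λ(a,b,x,y) p(a,b|x,y)`. -/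
def SyncGame.winProb {I O : Type*} [Fintype I] [Fintype O] (G : SyncGame I O)
    (π : I → I → ℝ) (p : Correlation I O) : ℝ :=
  ∑ x, ∑ y, π x y * ∑ a, ∑ b, (if G.rule a b x y then (1 : ℝ) else 0) * p a b x y

/-- The uniform distribution on question pairs. -/
def uniformPrior (I : Type*) [Fintype I] : I → I → ℝ :=
  fun _ _ => 1 / (Fintype.card I : ℝ) ^ 2

/-- The number of (undirected) edges of a graph. -/
def numEdges {V : Type*} (Γ : SimpleGraph V) : ℕ := Γ.edgeSet.ncard

open Classical in
/-- The uniform distribution on ordered pairs of vertices that form an edge. -/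
def edgePrior {V : Type*} (Γ : SimpleGraph V) : V → V → ℝ :=
  fun x y => if Γ.Adj x y then 1 / (2 * (numEdges Γ : ℝ)) else 0

/-- The 3-coloring game `Hom(Γ, K₃)`. -/
def coloringGame {V : Type*} (Γ : SimpleGraph V) : SyncGame V (Fin 3) where
  rule a b x y := ¬ (x = y ∧ a ≠ b) ∧ ¬ (Γ.Adj x y ∧ a = b)
  sync _ _ _ hab h := h.1 ⟨rfl, hab⟩

/-! ### Tracial von Neumann algebras and the models `loc`, `q`, `qa`, `qc` -/

/-- A faithful normal tracial state on a von Neumann algebra. -/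
structure FaithfulNormalTrace {H : Type u} [NormedAddCommGroup H] [InnerProductSpace ℂ H]
    [CompleteSpace H] (M : VonNeumannAlgebra H) where
  toLin : M.toStarSubalgebra →ₗ[ℂ] ℂ
  map_one : toLin 1 = 1
  nonneg : ∀ a, 0 ≤ toLin (star a * a)
  faithful : ∀ a, toLin (star a * a) = 0 → a = 0
  tracial : ∀ a b, toLin (a * b) = toLin (b * a)
  /-- Normality: the state preserves suprema of bounded increasing nets of positive elements.
  (Such a supremum, taken in the bounded operators, always lies in `M`.) -/
  normal : ∀ (S : Set M.toStarSubalgebra) (s : M.toStarSubalgebra), S.Nonempty →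
    (∀ a ∈ S, (0 : H →L[ℂ] H) ≤ a) →
    DirectedOn (fun a b : M.toStarSubalgebra => (a : H →L[ℂ] H) ≤ b) S →
    IsLUB ((fun a : M.toStarSubalgebra => (a : H →L[ℂ] H)) '' S) s →
    IsLUB ((fun a => (toLin a).re) '' S) (toLin s).re

/-- `M` has trivial center. -/
def IsFactor {H : Type u} [NormedAddCommGroup H] [InnerProductSpace ℂ H] [CompleteSpace H]
    (M : VonNeumannAlgebra H) : Prop :=
  ∀ a ∈ M, (∀ b ∈ M, a * b = b * a) → ∃ c : ℂ, a = c • (1 : H →L[ℂ] H)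

/-- `M` is generated, as a von Neumann algebra, by an increasing sequence of finite-dimensional
unital `*`-subalgebras. -/
def IsHyperfinite {H : Type u} [NormedAddCommGroup H] [InnerProductSpace ℂ H] [CompleteSpace H]
    (M : VonNeumannAlgebra H) : Prop :=
  ∃ F : ℕ → StarSubalgebra ℂ (H →L[ℂ] H), Monotone F ∧ (∀ k, FiniteDimensional ℂ (F k)) ∧
    (M : Set (H →L[ℂ] H)) =
      Set.centralizer (Set.centralizer (⋃ k, (F k : Set (H →L[ℂ] H))))

/-- `(M, τ)` is (isomorphic to) a tracial ultrapower `R^U` of the tracial von Neumann algebra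
`(R, τR)` by a free ultrafilter `U` on `ℕ`: it is a quotient of the algebra `ℓ^∞(ℕ, R)` of bounded
sequences such that `τ` of the class of `(x k)` is the limit of `τR (x k)` along `U`. As `τ` is
faithful, the kernel consists exactly of the sequences whose 2-norms tend to `0` along `U`. -/
def IsTracialUltrapower {H : Type u} [NormedAddCommGroup H] [InnerProductSpace ℂ H]
    [CompleteSpace H] (M : VonNeumannAlgebra H) (τ : FaithfulNormalTrace M)
    {K : Type u} [NormedAddCommGroup K] [InnerProductSpace ℂ K] [CompleteSpace K]
    (R : VonNeumannAlgebra K) (τR : FaithfulNormalTrace R) : Prop :=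
  ∃ U : Ultrafilter ℕ, (U : Filter ℕ) ≤ Filter.cofinite ∧
    ∃ q : BoundedContinuousFunction ℕ R.toStarSubalgebra →⋆ₐ[ℂ] M.toStarSubalgebra,
      Function.Surjective q ∧
      ∀ x, Filter.Tendsto (fun k => τR.toLin (x k)) U (nhds (τ.toLin (q x)))

/-- `(M, τ)` is a tracial ultrapower of the hyperfinite II₁ factor (an infinite-dimensional
hyperfinite factor with a faithful normal tracial state). -/
def IsHyperfiniteUltrapower {H : Type u} [NormedAddCommGroup H] [InnerProductSpace ℂ H]
    [CompleteSpace H] (M : VonNeumannAlgebra H) (τ : FaithfulNormalTrace M) : Prop :=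
  ∃ (K : Type u) (_ : NormedAddCommGroup K) (_ : InnerProductSpace ℂ K) (_ : CompleteSpace K)
    (R : VonNeumannAlgebra K) (τR : FaithfulNormalTrace R),
    IsFactor R ∧ ¬ FiniteDimensional ℂ R.toStarSubalgebra ∧ IsHyperfinite R ∧
    IsTracialUltrapower M τ R τR

/-- The four models of synchronous correlations. -/
inductive Model
  | loc | q | qa | qc

/-- The tracial von Neumann algebras allowed in each of the four models. -/
def Model.Admits (t : Model) {H : Type u} [NormedAddCommGroup H] [InnerProductSpace ℂ H]
    [CompleteSpace H] (M : VonNeumannAlgebra H) (τ : FaithfulNormalTrace M) : Prop :=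
  match t with
  | .loc => ∀ a ∈ M, ∀ b ∈ M, a * b = b * a
  | .q => FiniteDimensional ℂ M.toStarSubalgebra
  | .qa => IsHyperfiniteUltrapower M τ
  | .qc => True

/-- A projection-valued measure in `M` with outcome set `O`. -/
structure IsPVM {H : Type u} [NormedAddCommGroup H] [InnerProductSpace ℂ H] [CompleteSpace H]
    (M : VonNeumannAlgebra H) {O : Type*} [Fintype O] (E : O → M.toStarSubalgebra) : Prop where
  proj : ∀ a, IsStarProjection (E a)
  sum_eq_one : ∑ a, E a = 1

/-- `p(a,b|x,y) = τ(E_{a,x} E_{b,y})` for PVMs `(E_{a,x})_a` in `M`. -/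
def RealizedIn {H : Type u} [NormedAddCommGroup H] [InnerProductSpace ℂ H] [CompleteSpace H]
    (M : VonNeumannAlgebra H) (τ : FaithfulNormalTrace M) {I O : Type*} [Fintype O]
    (p : Correlation I O) : Prop :=
  ∃ E : O → I → M.toStarSubalgebra, (∀ x, IsPVM M (fun a => E a x)) ∧
    ∀ a b x y, (p a b x y : ℂ) = τ.toLin (E a x * E b y)

/-- The set of synchronous `t`-correlations with questions `I` and answers `O`. -/
def syncCorr (t : Model) (I O : Type*) [Fintype O] : Set (Correlation I O) :=
  {p | ∃ (H : Type u) (_ : NormedAddCommGroup H) (_ : InnerProductSpace ℂ H)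
    (_ : CompleteSpace H) (M : VonNeumannAlgebra H) (τ : FaithfulNormalTrace M),
    t.Admits M τ ∧ RealizedIn M τ p}

/-- The synchronous `t`-value of the game: the supremum of the winning probabilities over all
synchronous `t`-correlations, taken in the extended reals. -/
def syncValue (t : Model) {I O : Type*} [Fintype I] [Fintype O] (G : SyncGame I O)
    (π : I → I → ℝ) : EReal :=
  ⨆ p ∈ syncCorr.{u} t I O, (G.winProb π p : EReal)

/-! ### The graph `G_λ`

Questions are `Fin n` and answers are `Fin m`. All indices are counted from `0`: the answer
`a : Fin m` is the `(a+1)`-st answer, and likewise for `x : Fin n`, for the index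
`α : Fin (m - 2)` of the gadgets, and for the row and column indices `i j : Fin 3`. -/

variable {n m : ℕ}

/-- The answer is the first or the last one. -/
def IsEnd (a : Fin m) : Prop := a.val = 0 ∨ a.val = m - 1

/-- Losing tuples with both answers in `{1, m}`. -/
def SyncGame.InE (G : SyncGame (Fin n) (Fin m)) (a b : Fin m) (x y : Fin n) : Prop :=
  ¬ G.rule a b x y ∧ IsEnd a ∧ IsEnd b

/-- Losing tuples with both answers in `{2, …, m - 1}`. -/
def SyncGame.InF (G : SyncGame (Fin n) (Fin m)) (a b : Fin m) (x y : Fin n) : Prop :=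
  ¬ G.rule a b x y ∧ ¬ IsEnd a ∧ ¬ IsEnd b

/-- The vertices of all the pieces, before gluing: the control triangle `A, B, C`, the copies
`R_{α,x}` of `K₃ × K₃` with vertices `v i j α x`, the triangular prisms `T_{α,x}` with triangles
`s _ α x` and `t _ α x`, and the copies `Q_{a,b,x,y}` of `K₃ × K₃` with vertices
`q i j a b x y`. -/
inductive PreVertex (G : SyncGame (Fin n) (Fin m)) : Type
  | A
  | B
  | C
  | v (i j : Fin 3) (α : Fin (m - 2)) (x : Fin n)
  | s (i : Fin 3) (α : Fin (m - 2)) (x : Fin n)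
  | t (i : Fin 3) (α : Fin (m - 2)) (x : Fin n)
  | q (i j : Fin 3) (a b : Fin m) (x y : Fin n) (h : G.InE a b x y ∨ G.InF a b x y)

open Classical in
/-- `v̂(a,x)`: in 1-based indices it is `v(1,1,1,x)` for `a = 1`, `v(2,1,a-1,x)` for
`2 ≤ a ≤ m-1`, and `v(2,2,m-2,x)` for `a = m`. -/
def vhat (G : SyncGame (Fin n) (Fin m)) (hm : 3 ≤ m) (a : Fin m) (x : Fin n) : PreVertex G :=
  if h0 : a.val = 0 then .v 0 0 ⟨0, by omega⟩ x
  else if h1 : a.val = m - 1 then .v 1 1 ⟨m - 3, by omega⟩ x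
  else .v 1 0 ⟨a.val - 1, by omega⟩ x

/-- The identifications of vertices. -/
inductive Glue (G : SyncGame (Fin n) (Fin m)) (hm : 3 ≤ m) : PreVertex G → PreVertex G → Prop
  | v_B (α x) : Glue G hm (.v 0 1 α x) .B
  | v_v (α β : Fin (m - 2)) (x) (h : β.val = α.val + 1) : Glue G hm (.v 2 1 α x) (.v 0 0 β x)
  | q_left (a b x y h) : Glue G hm (.q 0 0 a b x y h) (vhat G hm a x)
  | q_right (a b x y h) : Glue G hm (.q 1 1 a b x y h) (vhat G hm b y)
  | q_B (a b x y h) (hE : G.InE a b x y) : Glue G hm (.q 0 1 a b x y h) .B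
  | q_C (a b x y h) (hF : G.InF a b x y) : Glue G hm (.q 0 1 a b x y h) .C
  | s_v (j α x) : Glue G hm (.s j α x) (.v 0 j α x)
  | t_A (α x) : Glue G hm (.t 1 α x) .A

/-- Adjacency in the pieces, together with the additional edges. In `K₃ × K₃` the vertices `(i,j)`
and `(k,l)` are adjacent iff exactly one of `i = k` and `j = l` holds. -/
inductive PreAdj (G : SyncGame (Fin n) (Fin m)) (hm : 3 ≤ m) : PreVertex G → PreVertex G → Prop
  | AB : PreAdj G hm .A .B
  | BC : PreAdj G hm .B .C
  | AC : PreAdj G hm .A .C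
  | v (i j k l α x) (h : Xor (i = k) (j = l)) : PreAdj G hm (.v i j α x) (.v k l α x)
  | q (i j k l a b x y hab) (h : Xor (i = k) (j = l)) :
      PreAdj G hm (.q i j a b x y hab) (.q k l a b x y hab)
  | s (i j α x) (h : i ≠ j) : PreAdj G hm (.s i α x) (.s j α x)
  | t (i j α x) (h : i ≠ j) : PreAdj G hm (.t i α x) (.t j α x)
  | st (i α x) : PreAdj G hm (.s i α x) (.t i α x)
  | A_v (α x) : PreAdj G hm .A (.v 2 2 α x)
  | C_v (α x) : PreAdj G hm .C (.v 1 0 α x)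
  | vhat_vhat (a b x y) (h : ¬ G.rule a b x y) (h' : ¬ (G.InE a b x y ∨ G.InF a b x y)) :
      PreAdj G hm (vhat G hm a x) (vhat G hm b y)
  | A_q (a b x y h) : PreAdj G hm .A (.q 2 2 a b x y h)

/-- The vertex set of `G_λ`: the pieces modulo the equivalence relation generated by the
identifications. -/
def Vertex (G : SyncGame (Fin n) (Fin m)) (hm : 3 ≤ m) : Type := Quot (Glue G hm)

/-- The graph `G_λ`: two (distinct) vertices are adjacent iff they have adjacent
representatives. -/
def gameGraph (G : SyncGame (Fin n) (Fin m)) (hm : 3 ≤ m) : SimpleGraph (Vertex G hm) :=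
  SimpleGraph.fromRel fun μ ν =>
    ∃ a b, PreAdj G hm a b ∧ Quot.mk (Glue G hm) a = μ ∧ Quot.mk (Glue G hm) b = ν

instance (G : SyncGame (Fin n) (Fin m)) : Finite (PreVertex G) := by
  let f : PreVertex G → Fin 3 ⊕ (Fin 3 × Fin 3 × Fin (m - 2) × Fin n) ⊕
      (Fin 3 × Fin (m - 2) × Fin n) ⊕ (Fin 3 × Fin (m - 2) × Fin n) ⊕
      (Fin 3 × Fin 3 × Fin m × Fin m × Fin n × Fin n) := fun w => match w with
    | .A => .inl 0
    | .B => .inl 1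
    | .C => .inl 2
    | .v i j α x => .inr (.inl (i, j, α, x))
    | .s i α x => .inr (.inr (.inl (i, α, x)))
    | .t i α x => .inr (.inr (.inr (.inl (i, α, x))))
    | .q i j a b x y _ => .inr (.inr (.inr (.inr (i, j, a, b, x, y))))
  refine Finite.of_injective f ?_
  intro w w' h
  cases w <;> cases w' <;> simp [f] at h ⊢ <;> exact h

instance (G : SyncGame (Fin n) (Fin m)) (hm : 3 ≤ m) : Fintype (Vertex G hm) :=
  have : Finite (Vertex G hm) := Quot.finite _
  Fintype.ofFinite _

end SyncGames

end

noncomputable section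

namespace SyncGames

/-! ### Spectral projections in a von Neumann algebra -/

section Spectral

variable {H : Type u} [NormedAddCommGroup H] [InnerProductSpace ℂ H] [CompleteSpace H]
  (M : VonNeumannAlgebra H)

/-! A projective strategy for `G` becomes a quantum 3-colouring of `G_λ` with projections in the
same `M` and the same trace, so the type of the model never changes. The vertices of a gadget `R` or
a prism `T` for the question `x` receive coarse-grainings of the one PVM `(E a x)_a`: each answer
selects a proper colouring of the piece, so its edges cost nothing. The gadgets for one `x` form a
chain that splits off one answer at a time, and `v̂(a,x)` has colour 0 exactly on `E a x`.

Only losing tuples cost anything. Put `e = E a x`, `f = E b y`. If `ef = 0`, then `(e, 1 - e - f,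
f)` is a PVM whose three outcomes select proper colourings of `Q`. In general `e` is first replaced
by a projection `e'` orthogonal to `f` with `‖e - e'‖₂² ≤ 3 τ(ef)` (`exists_orthogonal_projection`).
The corner `q(0,0)`, shared with `v̂(a,x)`, must keep the original `e`, and each edge then loses at
most `3 τ(ef)` (`loss_assign_q`). A direct edge between two `v̂` vertices loses only `τ(ef)`.

Charging every lossy edge to a losing tuple bounds the total loss by a multiple of `∑ τ(ef) = n² ε`
(`sum_loss_le`, `sum_losing_eq`). Division by the number of ordered edges gives the first claim, and
approximating the supremum gives the second (`le_syncValue_of_forall`). -/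

lemma cfc_mem {a : H →L[ℂ] H} (ha : a ∈ M) (g : ℝ → ℝ) : cfc g a ∈ M := by
  rw [← M.commutant_commutant, VonNeumannAlgebra.mem_commutant_iff]
  intro y hy
  rw [VonNeumannAlgebra.mem_commutant_iff] at hy
  exact (Commute.cfc_real (show Commute a y from hy a ha) g).symm.eq

/-- The projection onto the kernel of an element of `M` lies in `M`. -/
lemma starProjection_ker_mem {h : H →L[ℂ] H} (hh : h ∈ M) : h.ker.starProjection ∈ M := by
  rw [VonNeumannAlgebra.IsStarProjection.mem_iff isStarProjection_starProjection]
  intro y hy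
  rw [VonNeumannAlgebra.mem_commutant_iff] at hy
  rw [Submodule.range_starProjection, Module.End.mem_invtSubmodule]
  intro ξ hξ
  have h1 : h ξ = 0 := hξ
  have h2 := congrArg (fun T : H →L[ℂ] H => T ξ) (hy h hh)
  simp only [mul_apply_eq_comp, h1, map_zero] at h2
  exact h2

/-- The spectral projection of `a` for the interval `(1/2, ∞)`, with `h = (2a - 1)₊`. -/
lemma exists_spectral_projection {a : H →L[ℂ] H} (ha : a ∈ M) (h0 : 0 ≤ a) (h1 : a ≤ 1) :
    ∃ χ ∈ M, ∃ h ∈ M, ∃ b ∈ M, IsStarProjection χ ∧ χ * a + χ * a = χ + h ∧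
      a - (a * a + a * a) + h = star b * b ∧
      ∀ f : H →L[ℂ] H, a * f = 0 → χ * f = 0 := by
  have hsa : IsSelfAdjoint a := h0.isSelfAdjoint
  have hcp : Continuous fun t : ℝ => max (2 * t - 1) 0 := by fun_prop
  have hcm : Continuous fun t : ℝ => max (1 - 2 * t) 0 := by fun_prop
  have hct : Continuous fun t : ℝ => t := continuous_id
  set h := cfc (fun t : ℝ => max (2 * t - 1) 0) a with hh
  set h' := cfc (fun t : ℝ => max (1 - 2 * t) 0) a with hh'
  -- The indicator of `(1/2, ∞)` is discontinuous, so the spectral projection is obtained as `1 -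
  -- p`, the complement of the kernel projection of the continuous function `h` of `a`.
  set p := h.ker.starProjection with hp
  have hsp : IsStarProjection p := isStarProjection_starProjection
  have hpm : p ∈ M := starProjection_ker_mem M (cfc_mem M ha _)
  have hid : cfc (fun t : ℝ => t) a = a := cfc_id' ℝ a
  have hhsa : IsSelfAdjoint h := cfc_predicate _ a
  have hhp : h * p = 0 := by
    ext ξ
    exact (h.ker.starProjection_apply_mem ξ : _)
  have hph : p * h = 0 := by
    have := congrArg star hhp
    simpa [hhsa.star_eq, hsp.isSelfAdjoint.star_eq] using this
  have hhh' : h * h' = 0 := by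
    rw [hh, hh', ← cfc_mul _ _ a hcp.continuousOn hcm.continuousOn, ← cfc_const_zero ℝ a]
    congr 1
    ext t
    rcases le_total (2 * t) 1 with ht | ht
    · rw [max_eq_right (by linarith : 2 * t - 1 ≤ 0), zero_mul]
    · rw [max_eq_right (by linarith : 1 - 2 * t ≤ 0), mul_zero]
  have hph' : p * h' = h' := by
    ext ξ
    refine Submodule.starProjection_eq_self_iff.2 ?_
    exact congrArg (fun T : H →L[ℂ] H => T ξ) hhh'
  -- Positive and negative parts of `2a - 1`; multiplying by `1 - p` fixes `h` and kills `h'`.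
  have hdec : a + a = 1 + h - h' := by
    have h2 : cfc (fun t : ℝ => t + t) a = a + a := by
      rw [cfc_add a _ _ hct.continuousOn hct.continuousOn, hid]
    have h3 : cfc (fun t : ℝ => 1 + max (2 * t - 1) 0 - max (1 - 2 * t) 0) a = 1 + h - h' := by
      have hc1 : Continuous fun t : ℝ => 1 + max (2 * t - 1) 0 := by fun_prop
      rw [cfc_sub _ _ a hc1.continuousOn hcm.continuousOn,
        cfc_add a _ _ continuousOn_const hcp.continuousOn, cfc_const_one ℝ a]
    rw [← h2, ← h3]
    congr 1
    ext t
    rcases le_total (2 * t) 1 with ht | ht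
    · rw [max_eq_right (by linarith : 2 * t - 1 ≤ 0), max_eq_left (by linarith)]; ring
    · rw [max_eq_right (by linarith : 1 - 2 * t ≤ 0), max_eq_left (by linarith)]; ring
  have hspec : ∀ t ∈ spectrum ℝ a, 0 ≤ t ∧ t ≤ 1 := fun t ht =>
    ⟨spectrum_nonneg_of_nonneg h0 ht, (CFC.le_one_iff (R := ℝ) a).1 h1 t ht⟩
  refine ⟨1 - p, sub_mem (one_mem M) hpm, h, cfc_mem M ha _,
    cfc (fun t : ℝ => Real.sqrt (t - (t * t + t * t) + max (2 * t - 1) 0)) a, cfc_mem M ha _,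
    hsp.one_sub, ?_, ?_, ?_⟩
  · rw [← mul_add, hdec]
    simp only [sub_mul, mul_sub, mul_add, one_mul, hph, hph', mul_one]
    abel
  -- On `[0,1]` one has `2t² - t ≤ (2t - 1)₊`, so the difference has a real square root there.
  · have hs : IsSelfAdjoint
      (cfc (fun t : ℝ => Real.sqrt (t - (t * t + t * t) + max (2 * t - 1) 0)) a) :=
      cfc_predicate _ a
    have hcq : Continuous fun t : ℝ => t * t := hct.mul hct
    have hcq2 : Continuous fun t : ℝ => t * t + t * t := hcq.add hcq
    have hcd : Continuous fun t : ℝ => t - (t * t + t * t) := hct.sub hcq2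
    have hcs : Continuous fun t : ℝ => Real.sqrt (t - (t * t + t * t) + max (2 * t - 1) 0) :=
      (hcd.add hcp).sqrt
    have hsq : cfc (fun t : ℝ => t - (t * t + t * t) + max (2 * t - 1) 0) a
        = a - (a * a + a * a) + h := by
      rw [cfc_add a _ _ hcd.continuousOn hcp.continuousOn,
        cfc_sub _ _ a hct.continuousOn hcq2.continuousOn,
        cfc_add a _ _ hcq.continuousOn hcq.continuousOn,
        cfc_mul _ _ a hct.continuousOn hct.continuousOn, hid]
    rw [hs.star_eq, ← cfc_mul _ _ a hcs.continuousOn hcs.continuousOn, ← hsq]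
    refine cfc_congr fun t ht => ?_
    obtain ⟨ht0, ht1⟩ := hspec t ht
    refine (Real.mul_self_sqrt ?_).symm
    rcases le_total (2 * t) 1 with h | h
    · rw [max_eq_right (by linarith : 2 * t - 1 ≤ 0)]; nlinarith
    · rw [max_eq_left (by linarith : 0 ≤ 2 * t - 1)]; nlinarith
  · intro f hf
    -- Since `(2t - 1)₊` vanishes near 0, it is `t` times a continuous function; hence `h` kills
    -- whatever `a` kills.
    have hc : Continuous fun t : ℝ => max (2 * t - 1) 0 / max t (1 / 2) :=
      hcp.div (by fun_prop) fun t => (lt_of_lt_of_le (by norm_num) (le_max_right t (1 / 2))).ne'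
    have hm : cfc (fun t : ℝ => max (2 * t - 1) 0 / max t (1 / 2) * t) a
        = cfc (fun t : ℝ => max (2 * t - 1) 0 / max t (1 / 2)) a * a := by
      rw [cfc_mul _ _ a hc.continuousOn hct.continuousOn, hid]
    have hfac : h = cfc (fun t : ℝ => max (2 * t - 1) 0 / max t (1 / 2)) a * a := by
      rw [← hm, hh]
      congr 1
      ext t
      rcases le_total t (1 / 2) with ht | ht
      · rw [max_eq_right (by linarith : 2 * t - 1 ≤ 0)]; simp
      · rw [max_eq_left ht, div_mul_cancel₀ _ (by linarith)]
    have hhf : h * f = 0 := by rw [hfac, mul_assoc, hf, mul_zero]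
    rw [sub_mul, one_mul, sub_eq_zero]
    ext ξ
    refine (Submodule.starProjection_eq_self_iff.2 ?_).symm
    exact congrArg (fun T : H →L[ℂ] H => T ξ) hhf

end Spectral

/-! ### Traces of products of projections -/

section Trace

variable {H : Type u} [NormedAddCommGroup H] [InnerProductSpace ℂ H] [CompleteSpace H]
  {M : VonNeumannAlgebra H} (τ : FaithfulNormalTrace M)

/-- The real part of the trace. -/
def FaithfulNormalTrace.reTr (x : M.toStarSubalgebra) : ℝ := (τ.toLin x).re

namespace FaithfulNormalTrace

@[simp] lemma reTr_zero : τ.reTr 0 = 0 := by simp [reTr]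
@[simp] lemma reTr_one : τ.reTr 1 = 1 := by simp [reTr, τ.map_one]
@[simp] lemma reTr_add (x y) : τ.reTr (x + y) = τ.reTr x + τ.reTr y := by simp [reTr]
@[simp] lemma reTr_sub (x y) : τ.reTr (x - y) = τ.reTr x - τ.reTr y := by simp [reTr]
lemma reTr_sum {ι : Type*} (s : Finset ι) (f : ι → M.toStarSubalgebra) :
    τ.reTr (∑ i ∈ s, f i) = ∑ i ∈ s, τ.reTr (f i) := by simp [reTr]
lemma reTr_mul_comm (x y) : τ.reTr (x * y) = τ.reTr (y * x) := by simp [reTr, τ.tracial x y]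

lemma reTr_star_mul_self_nonneg (x) : 0 ≤ τ.reTr (star x * x) :=
  (Complex.nonneg_iff.1 (τ.nonneg x)).1

lemma eq_zero_of_reTr_eq_zero {x} (h : τ.reTr (star x * x) = 0) : x = 0 :=
  τ.faithful x (Complex.ext h (Complex.nonneg_iff.1 (τ.nonneg x)).2.symm)

variable {e f : M.toStarSubalgebra}

lemma toLin_mul_proj (he : IsStarProjection e) (hf : IsStarProjection f) :
    τ.toLin (e * f) = τ.toLin (star (e * f) * (e * f)) := by
  rw [star_mul, he.isSelfAdjoint.star_eq, hf.isSelfAdjoint.star_eq, mul_assoc, ← mul_assoc e,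
    he.isIdempotentElem.eq, τ.tracial f, mul_assoc, hf.isIdempotentElem.eq]

lemma reTr_mul_nonneg (he : IsStarProjection e) (hf : IsStarProjection f) :
    0 ≤ τ.reTr (e * f) := by
  rw [reTr, τ.toLin_mul_proj he hf]
  exact τ.reTr_star_mul_self_nonneg _

lemma ofReal_reTr_mul (he : IsStarProjection e) (hf : IsStarProjection f) :
    (τ.reTr (e * f) : ℂ) = τ.toLin (e * f) := by
  refine Complex.ext rfl ?_
  rw [τ.toLin_mul_proj he hf]
  exact (Complex.nonneg_iff.1 (τ.nonneg _)).2

/-- Two projections `e`, `f` can be made orthogonal by changing `e` by at most `3 τ(ef)` in the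
square of the 2-norm. -/
lemma exists_orthogonal_projection (he : IsStarProjection e) (hf : IsStarProjection f) :
    ∃ e' : M.toStarSubalgebra, IsStarProjection e' ∧ e' * f = 0 ∧
      τ.reTr e + τ.reTr e' - 2 * τ.reTr (e * e') ≤ 3 * τ.reTr (e * f) := by
  have hee := he.isIdempotentElem.eq
  have hff := hf.isIdempotentElem.eq
  have hes := he.isSelfAdjoint.star_eq
  have hfs := hf.isSelfAdjoint.star_eq
  have hgg : (1 - f) * (1 - f) = 1 - f := hf.one_sub.isIdempotentElem.eq
  have hgs : star (1 - f) = 1 - f := hf.one_sub.isSelfAdjoint.star_eq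
  have hes' : star (1 - e) = 1 - e := he.one_sub.isSelfAdjoint.star_eq
  have hee' : (1 - e) * (1 - e) = 1 - e := he.one_sub.isIdempotentElem.eq
  -- The compression of `e` to `1 - f` is orthogonal to `f` but only a positive contraction; its
  -- spectral projection `χ` for `(1/2, ∞)` will be `e'`.
  obtain ⟨a, ha⟩ : ∃ a, a = (1 - f) * e * (1 - f) := ⟨_, rfl⟩
  have haf : a * f = 0 := by rw [ha, mul_assoc, hf.one_sub_mul_self, mul_zero]
  have ha0 : a = star (e * (1 - f)) * (e * (1 - f)) := by
    rw [star_mul, hes, hgs, mul_assoc, ← mul_assoc e e, hee, ha, mul_assoc]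
  have ha1 : 1 - a = star f * f + star ((1 - e) * (1 - f)) * ((1 - e) * (1 - f)) := by
    rw [star_mul, hes', hgs, mul_assoc (1 - f), ← mul_assoc (1 - e), hee', hfs, hff,
      sub_mul 1 e, one_mul, mul_sub (1 - f) (1 - f), hgg, ha, mul_assoc]
    abel
  have hA0 : (0 : H →L[ℂ] H) ≤ a := by
    rw [ha0]
    exact star_mul_self_nonneg ((e * (1 - f) : M.toStarSubalgebra) : H →L[ℂ] H)
  have hA1 : (a : H →L[ℂ] H) ≤ 1 := by
    rw [← sub_nonneg]
    have := congrArg (fun x : M.toStarSubalgebra => (x : H →L[ℂ] H)) ha1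
    refine le_of_le_of_eq ?_ this.symm
    exact add_nonneg (star_mul_self_nonneg ((f : M.toStarSubalgebra) : H →L[ℂ] H))
      (star_mul_self_nonneg (((1 - e) * (1 - f) : M.toStarSubalgebra) : H →L[ℂ] H))
  obtain ⟨X, hX, h₀, hh, b₀, hb, hXp, hXa, hpos, hort⟩ :=
    exists_spectral_projection M (a := a) a.2 hA0 hA1
  obtain ⟨χ, rfl⟩ : ∃ χ : M.toStarSubalgebra, (χ : H →L[ℂ] H) = X := ⟨⟨X, hX⟩, rfl⟩
  obtain ⟨h, rfl⟩ : ∃ χ : M.toStarSubalgebra, (χ : H →L[ℂ] H) = h₀ := ⟨⟨h₀, hh⟩, rfl⟩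
  obtain ⟨b, rfl⟩ : ∃ χ : M.toStarSubalgebra, (χ : H →L[ℂ] H) = b₀ := ⟨⟨b₀, hb⟩, rfl⟩
  have hχ : IsStarProjection χ :=
    ⟨Subtype.ext hXp.isIdempotentElem, Subtype.ext hXp.isSelfAdjoint⟩
  have hχa : χ * a + χ * a = χ + h := Subtype.ext hXa
  have hpos : a - (a * a + a * a) + h = star b * b := Subtype.ext hpos
  have hχf : χ * f = 0 := Subtype.ext (hort f (congrArg Subtype.val haf))
  have hfχ : f * χ = 0 := by
    have := congrArg star hχf
    rwa [star_mul, hfs, hχ.isSelfAdjoint.star_eq, star_zero] at this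
  have t1 : τ.reTr (χ * a) = τ.reTr (e * χ) := by
    rw [ha, ← mul_assoc, ← mul_assoc, mul_sub χ, hχf, mul_one, sub_zero, reTr_mul_comm,
      ← mul_assoc, sub_mul, one_mul, hfχ, sub_zero, reTr_mul_comm]
  have t2 : τ.reTr a = τ.reTr e - τ.reTr (e * f) := by
    rw [ha, mul_assoc, reTr_mul_comm, mul_assoc, hgg, mul_sub, mul_one, reTr_sub]
  have t3 : τ.reTr (a * a)
      = τ.reTr e - 2 * τ.reTr (e * f) + τ.reTr (star (e * f * e) * (e * f * e)) := by
    have h1 : τ.reTr (a * a) = τ.reTr (e * (1 - f) * (e * (1 - f))) := by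
      rw [ha, mul_assoc (1 - f), mul_assoc, reTr_mul_comm]
      simp only [mul_assoc, hgg]
      rw [← mul_assoc (1 - f) (1 - f), hgg]
    have h2 : τ.reTr (star (e * f * e) * (e * f * e)) = τ.reTr (e * f * (e * f)) := by
      rw [star_mul, star_mul, hes, hfs, reTr_mul_comm, mul_assoc (e * f), ← mul_assoc e e, hee,
        reTr_mul_comm]
      simp only [mul_assoc]
      rw [← mul_assoc e e, hee]
    have h3 : τ.reTr (e * f * e) = τ.reTr (e * f) := by
      rw [reTr_mul_comm, ← mul_assoc, hee]
    rw [h1, h2, mul_sub, mul_one, sub_mul, mul_sub, mul_sub, hee, ← mul_assoc e e, hee]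
    simp only [reTr_sub, h3]
    ring
  have t4 := congrArg τ.reTr hχa
  have t5 := congrArg τ.reTr hpos
  have t6 := τ.reTr_star_mul_self_nonneg b
  have t7 := τ.reTr_star_mul_self_nonneg (e * f * e)
  simp only [reTr_add, reTr_sub] at t4 t5
  -- As `χ ≤ 1 - f`, `τ(eχ) = τ(aχ)`, so the left side is `τ(e) - τ(h)`. Moreover `τ(h) ≥ 2τ(a²) -
  -- τ(a)`, which is `τ(e) - 3τ(ef) + 2τ(efef)`, and the last term is nonnegative.
  exact ⟨χ, hχ, hχf, by linarith⟩

end FaithfulNormalTrace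

/-- The projections of a projection-valued measure are pairwise orthogonal. -/
lemma IsPVM.mul_eq_zero {O : Type*} [Fintype O] {E : O → M.toStarSubalgebra}
    (τ : FaithfulNormalTrace M) (hE : IsPVM M E) {a b : O} (hab : a ≠ b) : E a * E b = 0 := by
  classical
  -- The term `c = b` already exhausts the sum, so the other nonnegative terms vanish; faithfulness
  -- does the rest.
  have h1 : ∑ c, τ.reTr (E c * E b) = τ.reTr (E b) := by
    rw [← τ.reTr_sum, ← Finset.sum_mul, hE.sum_eq_one, one_mul]
  rw [← Finset.sum_erase_add _ _ (Finset.mem_univ b), (hE.proj b).isIdempotentElem.eq,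
    add_eq_right, Finset.sum_eq_zero_iff_of_nonneg
      fun c _ => τ.reTr_mul_nonneg (hE.proj c) (hE.proj b)] at h1
  have h2 := h1 a (Finset.mem_erase.2 ⟨hab, Finset.mem_univ a⟩)
  refine τ.eq_zero_of_reTr_eq_zero ?_
  rwa [FaithfulNormalTrace.reTr, ← τ.toLin_mul_proj (hE.proj a) (hE.proj b)]

end Trace

/-! ### Coarse-grainings of projection-valued measures and their losses -/

section Push

variable {H : Type u} [NormedAddCommGroup H] [InnerProductSpace ℂ H] [CompleteSpace H]
  {M : VonNeumannAlgebra H} {K : Type*} [Fintype K]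

/-- The image of a projection-valued measure under a colouring of its outcomes. -/
def push (F : K → M.toStarSubalgebra) (c : K → Fin 3) : Fin 3 → M.toStarSubalgebra :=
  fun z => ∑ k, if c k = z then F k else 0

/-- The measure with colour `c` on `e` and colour `d` on `1 - e`. -/
def two (e : M.toStarSubalgebra) (c d : Fin 3) : Fin 3 → M.toStarSubalgebra :=
  fun z => (if c = z then e else 0) + (if d = z then 1 - e else 0)

/-- The deterministic measure with colour `c`. -/
def cst (c : Fin 3) : Fin 3 → M.toStarSubalgebra := fun z => if c = z then 1 else 0

/-- The probability that two measures give the same colour. -/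
def loss (τ : FaithfulNormalTrace M) (P Q : Fin 3 → M.toStarSubalgebra) : ℝ := ∑ z, τ.reTr (P z * Q z)

lemma loss_comm (τ : FaithfulNormalTrace M) (P Q : Fin 3 → M.toStarSubalgebra) : loss τ P Q = loss τ Q P :=
  Finset.sum_congr rfl fun _ _ => τ.reTr_mul_comm _ _

lemma loss_push (τ : FaithfulNormalTrace M) (P : Fin 3 → M.toStarSubalgebra) (F : K → M.toStarSubalgebra) (c : K → Fin 3) :
    loss τ P (push F c) = ∑ k, τ.reTr (P (c k) * F k) := by
  simp only [loss, push, Finset.mul_sum, mul_ite, mul_zero, τ.reTr_sum]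
  rw [Finset.sum_comm]
  refine Finset.sum_congr rfl fun k _ => ?_
  rw [Finset.sum_eq_single (c k)]
  · simp
  · intro z _ hz
    simp [hz.symm]
  · simp

lemma loss_two (τ : FaithfulNormalTrace M) (e : M.toStarSubalgebra) (c d : Fin 3) (Q : Fin 3 → M.toStarSubalgebra) :
    loss τ (two e c d) Q = τ.reTr (e * Q c) + τ.reTr ((1 - e) * Q d) := by
  simp [loss, two, add_mul, Finset.sum_add_distrib, apply_ite τ.reTr]

lemma loss_cst (τ : FaithfulNormalTrace M) (c : Fin 3) (Q : Fin 3 → M.toStarSubalgebra) :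
    loss τ (cst c) Q = τ.reTr (Q c) := by
  simp [loss, cst, apply_ite τ.reTr]

variable {F : K → M.toStarSubalgebra}
lemma push_mul (τ : FaithfulNormalTrace M) (hF : IsPVM M F) (c : K → Fin 3) (z : Fin 3) (l : K) :
    push F c z * F l = if c l = z then F l else 0 := by
  rw [push, Finset.sum_mul, Finset.sum_eq_single l]
  · simp [ite_mul, (hF.proj l).isIdempotentElem.eq]
  · intro k _ hk
    simp [ite_mul, hF.mul_eq_zero τ hk]
  · simp

lemma isPVM_push (τ : FaithfulNormalTrace M) (hF : IsPVM M F) (c : K → Fin 3) : IsPVM M (push F c) where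
  proj z := by
    constructor
    · rw [IsIdempotentElem]
      nth_rewrite 2 [push]
      rw [Finset.mul_sum]
      refine Finset.sum_congr rfl fun l _ => ?_
      by_cases h : c l = z <;> simp [h, push_mul τ hF]
    · rw [isSelfAdjoint_iff, push, star_sum]
      exact Finset.sum_congr rfl fun k _ => by
        rw [apply_ite star, (hF.proj k).isSelfAdjoint.star_eq, star_zero]
  sum_eq_one := by
    simp only [push]
    rw [Finset.sum_comm, ← hF.sum_eq_one]
    simp

/-- Distinct outcomes of one PVM are orthogonal, so only pairs of equal outcomes contribute, and
these receive different colours. This makes edges inside a single-PVM piece free. -/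
lemma loss_push_push (τ : FaithfulNormalTrace M) (hF : IsPVM M F) {c d : K → Fin 3} (h : ∀ k, c k ≠ d k) :
    loss τ (push F c) (push F d) = 0 := by
  rw [loss_push]
  exact Finset.sum_eq_zero fun k _ => by simp [push_mul τ hF, h k]

lemma push_eq_two [DecidableEq K] (hF : IsPVM M F) {c : K → Fin 3} (k : K) {a b : Fin 3}
    (h : ∀ l, c l = if l = k then a else b) : push F c = two (F k) a b := by
  ext1 z
  have hs : ∑ l ∈ Finset.univ.erase k, F l = 1 - F k := by
    rw [← hF.sum_eq_one, eq_sub_iff_add_eq, Finset.sum_erase_add _ _ (Finset.mem_univ k)]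
  rw [push, two, ← Finset.add_sum_erase _ _ (Finset.mem_univ k), h k, if_pos rfl, ← hs]
  congr 1
  by_cases hz : b = z
  · rw [if_pos hz]
    exact Finset.sum_congr rfl fun l hl => by
      rw [h l, if_neg (Finset.ne_of_mem_erase hl), if_pos hz]
  · rw [if_neg hz]
    exact Finset.sum_eq_zero fun l hl => by
      rw [h l, if_neg (Finset.ne_of_mem_erase hl), if_neg hz]

lemma push_const (hF : IsPVM M F) (c : Fin 3) : push F (fun _ => c) = cst c := by
  ext1 z
  rw [push, cst, ← hF.sum_eq_one]
  split_ifs <;> simp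

end Push

/-! ### Orthogonalised triples -/

section Triple

variable {H : Type u} [NormedAddCommGroup H] [InnerProductSpace ℂ H] [CompleteSpace H]
  {M : VonNeumannAlgebra H}

open Classical in
/-- A projection orthogonal to `f` and close to `e`. -/
def orthProj (τ : FaithfulNormalTrace M) (e f : M.toStarSubalgebra) : M.toStarSubalgebra :=
  if h : IsStarProjection e ∧ IsStarProjection f then
    (τ.exists_orthogonal_projection h.1 h.2).choose
  -- A junk value, so that the measures can be defined without carrying proofs.
  else 0

lemma orthProj_spec (τ : FaithfulNormalTrace M) {e f : M.toStarSubalgebra}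
    (he : IsStarProjection e) (hf : IsStarProjection f) :
    IsStarProjection (orthProj τ e f) ∧ orthProj τ e f * f = 0 ∧
      τ.reTr e + τ.reTr (orthProj τ e f) - 2 * τ.reTr (e * orthProj τ e f)
        ≤ 3 * τ.reTr (e * f) := by
  rw [orthProj, dif_pos ⟨he, hf⟩]
  exact (τ.exists_orthogonal_projection he hf).choose_spec

/-- The measure `(e', 1 - e' - f, f)` with `e'` orthogonal to `f` and close to `e`. -/
def triple (τ : FaithfulNormalTrace M) (e f : M.toStarSubalgebra) : Fin 3 → M.toStarSubalgebra :=
  ![orthProj τ e f, 1 - f - orthProj τ e f, f]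

lemma isPVM_triple (τ : FaithfulNormalTrace M) {e f : M.toStarSubalgebra}
    (he : IsStarProjection e) (hf : IsStarProjection f) : IsPVM M (triple τ e f) where
  proj k := by
    obtain ⟨h1, h2, -⟩ := orthProj_spec τ he hf
    fin_cases k
    · exact h1
    · exact h1.sub_of_mul_eq_left hf.one_sub (by rw [mul_sub, mul_one, h2, sub_zero])
    · exact hf
  sum_eq_one := by
    simp [Fin.sum_univ_three, triple]

/-- With `e'` the first entry of the triple, `‖e - e'‖₂² = τ(e(1 - e' - f)) + τ(ef) + τ((1 - e)e')`.
All three terms are nonnegative, so any partial sum inherits the bound. These two are exactly the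
losses met in a gadget `Q`. -/
lemma reTr_triple_bound (τ : FaithfulNormalTrace M) {e f : M.toStarSubalgebra}
    (he : IsStarProjection e) (hf : IsStarProjection f) :
    τ.reTr (e * triple τ e f 1) ≤ 3 * τ.reTr (e * f) ∧
      τ.reTr ((1 - e) * triple τ e f 0) + τ.reTr (e * f) ≤ 3 * τ.reTr (e * f) := by
  obtain ⟨-, -, h3⟩ := orthProj_spec τ he hf
  have hp := isPVM_triple τ he hf
  have h4 := τ.reTr_mul_nonneg he (hp.proj 1)
  have h5 := τ.reTr_mul_nonneg he.one_sub (hp.proj 0)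
  have h6 := τ.reTr_mul_nonneg he hf
  simp only [triple, Matrix.cons_val_zero, Matrix.cons_val_one, mul_sub, sub_mul, one_mul,
    mul_one, FaithfulNormalTrace.reTr_sub] at h4 h5 ⊢
  constructor <;> linarith

end Triple

/-! ### Colouring the graph -/

section Colouring

/-- The three colourings of `K₃ × K₃` whose entry at `(0, 1)` is `1`. -/
def latin (k i j : Fin 3) : Fin 3 := ![i + j, 2 + i - j, 2 - i - j] k

/-- Each colouring is affine over `ℤ/3` with nonzero coefficients in both coordinates, so changing
exactly one coordinate changes the colour. The remaining sign pattern with value 1 at `(0,1)`,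
namely `j - i`, is not used: it has the forbidden colour 0 at `(2,2)`. -/
lemma latin_ne {i j k l : Fin 3} (h : Xor (i = k) (j = l)) (s : Fin 3) :
    latin s i j ≠ latin s k l := by
  revert i j k l s
  unfold Xor
  decide

variable {n m : ℕ}

/-- Which of the three colourings of the gadget with index `α` is used for the answer `a`. -/
def stage (α : ℕ) (a : Fin m) : Fin 3 :=
  if a.val ≤ α then 0 else if a.val = α + 1 then 1 else 2

open Classical in
/-- The colours `1` and `2` are exchanged unless `a` is the first or the last answer. -/
def twist (a : Fin m) (c : Fin 3) : Fin 3 := if IsEnd a then c else -c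

lemma twist_injective (a : Fin m) : Function.Injective (twist a) := by
  intro c d h
  unfold twist at h
  split_ifs at h
  · exact h
  · exact neg_injective h

@[simp] lemma twist_zero (a : Fin m) : twist a 0 = 0 := by simp [twist]

lemma twist_two_ne_zero (a : Fin m) : twist a 2 ≠ 0 := by
  unfold twist
  split_ifs <;> decide

variable {H : Type u} [NormedAddCommGroup H] [InnerProductSpace ℂ H] [CompleteSpace H]
  {M : VonNeumannAlgebra H} {G : SyncGame (Fin n) (Fin m)}

/-- The measures assigned to the vertices of the pieces. -/
def assign (τ : FaithfulNormalTrace M) (E : Fin m → Fin n → M.toStarSubalgebra) :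
    PreVertex G → Fin 3 → M.toStarSubalgebra
  | .A => cst 0
  | .B => cst 1
  | .C => cst 2
  | .v i j α x => push (fun a => E a x) fun a => latin (stage α a) i j
  | .s j α x => push (fun a => E a x) fun a => latin (stage α a) 0 j
  | .t j α x => push (fun a => E a x) fun a => latin (stage α a) 0 j - 1
  | .q i j a b x y _ =>
    -- In row 0 the unperturbed `e` is kept: `(0,0)` is glued to `v̂(a,x)`, and `(0,2)` carries the
    -- same measure with its two colours exchanged, so the row is loss-free. All other entries use
    -- the orthogonalised triple.
    if i = 0 ∧ j = 0 then two (E a x) 0 (twist a 2)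
    else if i = 0 ∧ j = 2 then two (E a x) (twist a 2) 0
    else push (triple τ (E a x) (E b y)) fun k => twist a (latin k i j)

/-! ### Compatibility of the measures with the gluing -/

variable (τ : FaithfulNormalTrace M) {E : Fin m → Fin n → M.toStarSubalgebra}

/-- The entries `(0,0)`, `(1,0)`, `(1,1)` have colour 0 only in stage 0, 1, 2 respectively. In the
first gadget stage 0 is the first answer alone, in gadget `α` stage 1 is the answer `α + 1`, and in
the last gadget stage 2 is the last answer alone. The other colour is 2 at the ends and 1 in
between, which is what `twist` records. -/
lemma assign_vhat (hE : ∀ x, IsPVM M fun a => E a x) (hm : 3 ≤ m) (a : Fin m) (x : Fin n) :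
    assign τ E (vhat G hm a x) = two (E a x) 0 (twist a 2) := by
  unfold vhat
  split_ifs with h0 h1
  · refine push_eq_two (hE x) a fun l => ?_
    have : IsEnd a := Or.inl h0
    simp only [twist, this, if_true, stage, Fin.ext_iff, h0]
    split_ifs <;> first | omega | decide
  · refine push_eq_two (hE x) a fun l => ?_
    have : IsEnd a := Or.inr h1
    have := l.2
    simp only [twist, IsEnd, stage, Fin.ext_iff, h1, or_true, if_true]
    split_ifs <;> first | omega | decide
  · refine push_eq_two (hE x) a fun l => ?_
    have : ¬ IsEnd a := by rintro (h | h) <;> contradiction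
    simp only [twist, this, if_false, stage, Fin.ext_iff]
    split_ifs <;> first | omega | decide

lemma assign_q_left {a b : Fin m} {x y : Fin n} (h) :
    assign (G := G) τ E (.q 0 0 a b x y h) = two (E a x) 0 (twist a 2) := by
  simp [assign]

lemma assign_q_right (hE : ∀ x, IsPVM M fun a => E a x) {a b : Fin m}
    {x y : Fin n} (h : G.InE a b x y ∨ G.InF a b x y) :
    assign (G := G) τ E (.q 1 1 a b x y h) = two (E b y) 0 (twist b 2) := by
  -- This is where it matters that `a` and `b` are both end answers or both middle answers.
  have hab : twist a 2 = twist b 2 := by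
    rcases h with ⟨-, h1, h2⟩ | ⟨-, h1, h2⟩ <;> simp [twist, h1, h2]
  have hp := isPVM_triple τ ((hE x).proj a) ((hE y).proj b)
  rw [← hab]
  simp only [assign, one_ne_zero, false_and, if_false]
  refine push_eq_two hp 2 fun k => ?_
  match k with
  | 0 => exact (if_neg (by decide : ¬ (0 : Fin 3) = 2)).symm
  | 1 => exact (if_neg (by decide : ¬ (1 : Fin 3) = 2)).symm
  | 2 => exact twist_zero a

lemma assign_q_mid (hE : ∀ x, IsPVM M fun a => E a x) {a b : Fin m}
    {x y : Fin n} (h : G.InE a b x y ∨ G.InF a b x y) :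
    assign (G := G) τ E (.q 0 1 a b x y h) = cst (twist a 1) := by
  have hp := isPVM_triple τ ((hE x).proj a) ((hE y).proj b)
  rw [← push_const hp]
  simp only [assign]
  rw [if_neg (by decide), if_neg (by decide)]
  congr 1
  ext1 k
  fin_cases k <;> rfl

lemma isPVM_assign (hE : ∀ x, IsPVM M fun a => E a x) (w : PreVertex G) : IsPVM M (assign τ E w) := by
  have hc : ∀ c : Fin 3, IsPVM M (cst c) := fun c => by
    rw [← push_const (K := Unit) (F := fun _ => (1 : M.toStarSubalgebra))
      ⟨fun _ => .one _, by simp⟩]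
    exact isPVM_push τ ⟨fun _ => .one _, by simp⟩ _
  have ht : ∀ a x (c d : Fin 3), IsPVM M (two (E a x) c d) := fun a x c d => by
    rw [← push_eq_two (hE x) (c := fun l => if l = a then c else d) a fun _ => rfl]
    exact isPVM_push τ (hE x) _
  cases w with
  | A => exact hc _
  | B => exact hc _
  | C => exact hc _
  | v i j α x => exact isPVM_push τ (hE x) _
  | s j α x => exact isPVM_push τ (hE x) _
  | t j α x => exact isPVM_push τ (hE x) _
  | q i j a b x y h =>
    simp only [assign]
    split_ifs
    · exact ht _ _ _ _
    · exact ht _ _ _ _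
    · exact isPVM_push τ (isPVM_triple τ ((hE x).proj a) ((hE y).proj b)) _

lemma assign_glue (hE : ∀ x, IsPVM M fun a => E a x) (hm : 3 ≤ m) {u w : PreVertex G} (h : Glue G hm u w) :
    assign τ E u = assign τ E w := by
  cases h with
  | v_B α x =>
    refine Eq.trans ?_ (push_const (hE x) 1)
    simp only [assign]
    congr 1
    ext1 k
    generalize stage α.val k = s
    fin_cases s <;> rfl
  | v_v α β x h =>
    -- Stages 0 and 1 of gadget `α` merge into stage 0 of gadget `α + 1`: both sides have colour 0
    -- for answers up to `α + 1` and colour 2 afterwards.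
    simp only [assign]
    congr 1
    ext1 k
    simp only [stage, h]
    split_ifs <;> first | omega | decide
  | q_left a b x y h => rw [assign_vhat τ hE, assign_q_left τ]
  | q_right a b x y h => rw [assign_vhat τ hE, assign_q_right τ hE]
  | q_B a b x y h hE' =>
    rw [assign_q_mid τ hE, twist, if_pos hE'.2.1]
    rfl
  | q_C a b x y h hF =>
    rw [assign_q_mid τ hE, twist, if_neg hF.2.1]
    rfl
  | s_v j α x => rfl
  | t_A α x =>
    refine Eq.trans ?_ (push_const (hE x) 0)
    simp only [assign]
    congr 1
    ext1 k
    generalize stage α.val k = s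
    fin_cases s <;> rfl

/-! ### Losses on the edges -/

lemma loss_cst_push {K : Type*} [Fintype K] {F : K → M.toStarSubalgebra} (hF : IsPVM M F)
    (z : Fin 3) {c : K → Fin 3} (h : ∀ k, z ≠ c k) : loss τ (cst z) (push F c) = 0 := by
  rw [← push_const hF]
  exact loss_push_push τ hF h


lemma loss_two_comm_zero {e : M.toStarSubalgebra} (he : IsStarProjection e) {c d : Fin 3}
    (hcd : c ≠ d) : loss τ (two e c d) (two e d c) = 0 := by
  rw [loss_two]
  simp [two, hcd, hcd.symm, he.mul_one_sub_self, he.one_sub_mul_self]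

/-- The loss on an edge of a gadget `Q` is at most `3 τ(ef)`. -/
lemma loss_assign_q (hE : ∀ x, IsPVM M fun a => E a x) {a b : Fin m} {x y : Fin n}
    (h : G.InE a b x y ∨ G.InF a b x y) {i j k l : Fin 3} (hx : Xor (i = k) (j = l)) :
    loss τ (assign (G := G) τ E (.q i j a b x y h)) (assign (G := G) τ E (.q k l a b x y h))
      ≤ 3 * τ.reTr (E a x * E b y) := by
  have he := (hE x).proj a
  have hf := (hE y).proj b
  have hp := isPVM_triple τ he hf
  have hδ : 0 ≤ 3 * τ.reTr (E a x * E b y) := mul_nonneg (by norm_num) (τ.reTr_mul_nonneg he hf)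
  obtain ⟨hb1, hb2⟩ := reTr_triple_bound τ he hf
  have h0 : triple τ (E a x) (E b y) 2 = E b y := rfl
  have hq00 := assign_q_left (G := G) (E := E) τ h
  have hq02 : assign (G := G) τ E (.q 0 2 a b x y h) = two (E a x) (twist a 2) 0 := rfl
  have hq : ∀ {i j : Fin 3}, ¬ (i = 0 ∧ j = 0) → ¬ (i = 0 ∧ j = 2) →
      assign (G := G) τ E (.q i j a b x y h)
        = push (triple τ (E a x) (E b y)) fun s => twist a (latin s i j) := fun h1 h2 => by
    simp only [assign]
    rw [if_neg h1, if_neg h2]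
  have h2 : twist a 2 ≠ 0 := twist_two_ne_zero a
  have h12 : twist a 1 ≠ twist a 2 := (twist_injective a).ne (by decide)
  have h10 : twist a 1 ≠ 0 := by
    rw [← twist_zero a]; exact (twist_injective a).ne (by decide)
  -- Row 0 is free. Towards `(1,0)` the loss is `τ(e(1 - e' - f))`, towards `(2,0)` it is `τ((1 -
  -- e)e') + τ(ef)`.
  have hP : ∀ {k l : Fin 3}, Xor (0 = k) (0 = l) →
      loss τ (assign (G := G) τ E (.q 0 0 a b x y h)) (assign (G := G) τ E (.q k l a b x y h))
        ≤ 3 * τ.reTr (E a x * E b y) := by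
    intro k l hx
    have hk : (k = 0 ∧ l = 1) ∨ (k = 0 ∧ l = 2) ∨ (k = 1 ∧ l = 0) ∨ (k = 2 ∧ l = 0) := by
      revert k l; unfold Xor; decide
    rcases hk with ⟨rfl, rfl⟩ | ⟨rfl, rfl⟩ | ⟨rfl, rfl⟩ | ⟨rfl, rfl⟩
    · rw [hq00, assign_q_mid τ hE, loss_two]
      simpa [cst, h12, h10] using hδ
    · rw [hq00, hq02, loss_two_comm_zero τ he h2.symm]
      exact hδ
    · rw [hq00, hq (by decide) (by decide), loss_push, Fin.sum_univ_three,
        show latin 0 1 0 = 1 from rfl, show latin 1 1 0 = 0 from rfl,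
        show latin 2 1 0 = 1 from rfl]
      simpa [two, h10.symm, h12.symm, h2] using hb1
    · rw [hq00, hq (by decide) (by decide), loss_push, Fin.sum_univ_three,
        show latin 0 2 0 = 2 from rfl, show latin 1 2 0 = 1 from rfl,
        show latin 2 2 0 = 0 from rfl]
      simpa [two, h10.symm, h12.symm, h2, h2.symm, h0] using hb2
  -- The same two quantities occur in column 2, with the rows 1 and 2 exchanged.
  have hP' : ∀ {k l : Fin 3}, Xor (0 = k) (2 = l) →
      loss τ (assign (G := G) τ E (.q 0 2 a b x y h)) (assign (G := G) τ E (.q k l a b x y h))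
        ≤ 3 * τ.reTr (E a x * E b y) := by
    intro k l hx
    have hk : (k = 0 ∧ l = 1) ∨ (k = 0 ∧ l = 0) ∨ (k = 1 ∧ l = 2) ∨ (k = 2 ∧ l = 2) := by
      revert k l; unfold Xor; decide
    rcases hk with ⟨rfl, rfl⟩ | ⟨rfl, rfl⟩ | ⟨rfl, rfl⟩ | ⟨rfl, rfl⟩
    · rw [hq02, assign_q_mid τ hE, loss_two]
      simpa [cst, h12, h10] using hδ
    · rw [hq00, hq02, loss_two_comm_zero τ he h2]
      exact hδ
    · rw [hq02, hq (by decide) (by decide), loss_push, Fin.sum_univ_three,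
        show latin 0 1 2 = 0 from rfl, show latin 1 1 2 = 1 from rfl,
        show latin 2 1 2 = 2 from rfl]
      simpa [two, h10.symm, h12.symm, h2, h2.symm, h0] using hb2
    · rw [hq02, hq (by decide) (by decide), loss_push, Fin.sum_univ_three,
        show latin 0 2 2 = 1 from rfl, show latin 1 2 2 = 2 from rfl,
        show latin 2 2 2 = 1 from rfl]
      simpa [two, h10.symm, h12.symm, h2, h2.symm] using hb1
  by_cases h1 : i = 0 ∧ j = 0
  · obtain ⟨rfl, rfl⟩ := h1
    exact hP hx
  by_cases h1' : i = 0 ∧ j = 2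
  · obtain ⟨rfl, rfl⟩ := h1'
    exact hP' hx
  have hx' : Xor (k = i) (l = j) := by rwa [eq_comm, @eq_comm _ l]
  by_cases h3 : k = 0 ∧ l = 0
  · obtain ⟨rfl, rfl⟩ := h3
    rw [loss_comm]
    exact hP hx'
  by_cases h3' : k = 0 ∧ l = 2
  · obtain ⟨rfl, rfl⟩ := h3'
    rw [loss_comm]
    exact hP' hx'
  -- Away from the two special corners both ends coarse-grain the same triple.
  rw [hq h1 h1', hq h3 h3',
    loss_push_push τ hp fun s hs => latin_ne hx s (twist_injective a hs)]
  exact hδ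

/-- The loss on an edge between `v̂(a,x)` and `v̂(b,y)`. -/
lemma loss_vhat (hE : ∀ x, IsPVM M fun a => E a x) (hm : 3 ≤ m) {a b : Fin m} {x y : Fin n}
    (h : ¬ G.rule a b x y) (h' : ¬ (G.InE a b x y ∨ G.InF a b x y)) :
    loss τ (assign τ E (vhat G hm a x)) (assign τ E (vhat G hm b y))
      ≤ 3 * τ.reTr (E a x * E b y) := by
  have hδ := τ.reTr_mul_nonneg ((hE x).proj a) ((hE y).proj b)
  -- Exactly one of the two answers is an end answer, so the colours on `1 - e` and `1 - f` differ
  -- and the only common colour is 0, on `e` and `f`.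
  have hab : twist a 2 ≠ twist b 2 := by
    unfold twist
    split_ifs with h1 h2 h2
    · exact absurd (Or.inl ⟨h, h1, h2⟩) h'
    · decide
    · decide
    · exact absurd (Or.inr ⟨h, h1, h2⟩) h'
  rw [assign_vhat τ hE, assign_vhat τ hE, loss_two]
  simp only [two, twist_two_ne_zero, (twist_two_ne_zero _).symm, hab.symm, if_true, if_false,
    add_zero, mul_zero, FaithfulNormalTrace.reTr_zero]
  linarith

/-- A family of at most 81 ordered pairs of vertices that contains the ends of all the edges that
the losing tuple `(a,b,x,y)` contributes, in both orientations. -/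
def lossyPair (G : SyncGame (Fin n) (Fin m)) (hm : 3 ≤ m) (a b : Fin m) (x y : Fin n)
    (s : Fin 3 × Fin 3 × Fin 3 × Fin 3) : Vertex G hm × Vertex G hm :=
  open Classical in
  if h : G.InE a b x y ∨ G.InF a b x y then
    (Quot.mk _ (.q s.1 s.2.1 a b x y h), Quot.mk _ (.q s.2.2.1 s.2.2.2 a b x y h))
  else if s.1 = 0 then (Quot.mk _ (vhat G hm a x), Quot.mk _ (vhat G hm b y))
  else (Quot.mk _ (vhat G hm b y), Quot.mk _ (vhat G hm a x))

/-- The measures assigned to the vertices of `G_λ`. -/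
def vertexPVM (hm : 3 ≤ m) (hE : ∀ x, IsPVM M fun a => E a x) (μ : Vertex G hm) :
    Fin 3 → M.toStarSubalgebra :=
  Quot.lift (assign τ E) (fun _ _ h => assign_glue τ hE hm h) μ

lemma isPVM_vertexPVM (hm : 3 ≤ m) (hE : ∀ x, IsPVM M fun a => E a x) (μ : Vertex G hm) :
    IsPVM M (vertexPVM τ hm hE μ) := by
  induction μ using Quot.ind with
  | mk w => exact isPVM_assign τ hE w

/-- Edges within the pieces `R` and `T`, and those at the control triangle, are free; only `Q` edges
and direct `v̂` edges are charged to a losing tuple. Both orientations are recorded because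
adjacency in the graph is the symmetrised relation. -/
lemma loss_preAdj (hE : ∀ x, IsPVM M fun a => E a x) (hm : 3 ≤ m) {u w : PreVertex G}
    (h : PreAdj G hm u w) :
    loss τ (assign τ E u) (assign τ E w) = 0 ∨ ∃ a b x y, ¬ G.rule a b x y ∧
      loss τ (assign τ E u) (assign τ E w) ≤ 3 * τ.reTr (E a x * E b y) ∧
      (∃ s, lossyPair G hm a b x y s = (Quot.mk _ u, Quot.mk _ w)) ∧
      (∃ s, lossyPair G hm a b x y s = (Quot.mk _ w, Quot.mk _ u)) := by
  cases h with
  | AB => exact Or.inl (by simp [assign, loss_cst, cst])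
  | BC => exact Or.inl (by simp [assign, loss_cst, cst])
  | AC => exact Or.inl (by simp [assign, loss_cst, cst])
  | v i j k l α x h => exact Or.inl (loss_push_push τ (hE x) fun s => latin_ne h _)
  | q i j k l a b x y hab h =>
    refine Or.inr ⟨a, b, x, y, hab.elim (·.1) (·.1), loss_assign_q τ hE hab h,
      ⟨(i, j, k, l), dif_pos hab⟩, ⟨(k, l, i, j), dif_pos hab⟩⟩
  | s i j α x h =>
    exact Or.inl (loss_push_push τ (hE x) fun s => latin_ne (Or.inl ⟨rfl, h⟩) _)
  | t i j α x h =>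
    exact Or.inl (loss_push_push τ (hE x) fun s hs =>
      latin_ne (Or.inl ⟨rfl, h⟩) _ (sub_left_injective hs))
  | st i α x =>
    exact Or.inl (loss_push_push τ (hE x) fun s => (by decide : ∀ c : Fin 3, c ≠ c - 1) _)
  | A_v α x =>
    refine Or.inl (loss_cst_push τ (hE x) 0 fun s => ?_)
    generalize stage α.val s = c
    revert c
    decide
  | C_v α x =>
    refine Or.inl (loss_cst_push τ (hE x) 2 fun s => ?_)
    generalize stage α.val s = c
    revert c
    decide
  | vhat_vhat a b x y h h' =>
    refine Or.inr ⟨a, b, x, y, h, loss_vhat τ hE hm h h', ⟨(0, 0, 0, 0), ?_⟩,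
      ⟨(1, 0, 0, 0), ?_⟩⟩ <;> rw [lossyPair, dif_neg h']
    · rfl
    · rfl
  | A_q a b x y h =>
    refine Or.inl (loss_cst_push τ (isPVM_triple τ ((hE x).proj a) ((hE y).proj b)) 0 fun s => ?_)
    rw [← twist_zero a]
    refine (twist_injective a).ne ?_
    revert s
    decide

lemma loss_adj (hE : ∀ x, IsPVM M fun a => E a x) (hm : 3 ≤ m) {μ ν : Vertex G hm}
    (h : (gameGraph G hm).Adj μ ν) :
    loss τ (vertexPVM τ hm hE μ) (vertexPVM τ hm hE ν) = 0 ∨ ∃ a b x y, ¬ G.rule a b x y ∧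
      loss τ (vertexPVM τ hm hE μ) (vertexPVM τ hm hE ν) ≤ 3 * τ.reTr (E a x * E b y) ∧
      ∃ s, lossyPair G hm a b x y s = (μ, ν) := by
  rw [gameGraph, SimpleGraph.fromRel_adj] at h
  obtain ⟨-, ⟨u, w, h, rfl, rfl⟩ | ⟨u, w, h, rfl, rfl⟩⟩ := h
  · rcases loss_preAdj τ hE hm h with h0 | ⟨a, b, x, y, h1, h2, h3, -⟩
    · exact Or.inl h0
    · exact Or.inr ⟨a, b, x, y, h1, h2, h3⟩
  · rw [loss_comm]
    rcases loss_preAdj τ hE hm h with h0 | ⟨a, b, x, y, h1, h2, -, h3⟩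
    · exact Or.inl h0
    · exact Or.inr ⟨a, b, x, y, h1, h2, h3⟩

open Classical in
/-- The total loss over all ordered edges. -/
lemma sum_loss_le (hE : ∀ x, IsPVM M fun a => E a x) (hm : 3 ≤ m) :
    ∑ μ : Vertex G hm, ∑ ν : Vertex G hm, (if (gameGraph G hm).Adj μ ν then
        loss τ (vertexPVM τ hm hE μ) (vertexPVM τ hm hE ν) else 0)
      ≤ 243 * ∑ x, ∑ y, ∑ a, ∑ b,
        (if G.rule a b x y then 0 else τ.reTr (E a x * E b y)) := by
  have hδ : ∀ a b x y, 0 ≤ if G.rule a b x y then 0 else τ.reTr (E a x * E b y) :=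
    fun a b x y => by
      split_ifs
      · rfl
      · exact τ.reTr_mul_nonneg ((hE x).proj a) ((hE y).proj b)
  let T := Fin n × Fin n × Fin m × Fin m
  let S := Fin 3 × Fin 3 × Fin 3 × Fin 3
  let δ : T → ℝ := fun κ =>
    if G.rule κ.2.2.1 κ.2.2.2 κ.1 κ.2.1 then 0 else τ.reTr (E κ.2.2.1 κ.1 * E κ.2.2.2 κ.2.1)
  let φ : T → S → Vertex G hm × Vertex G hm := fun κ =>
    lossyPair G hm κ.2.2.1 κ.2.2.2 κ.1 κ.2.1
  have hδ' : ∀ κ, 0 ≤ δ κ := fun κ => hδ _ _ _ _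
  have hterm : ∀ κ s μ, 0 ≤ if φ κ s = μ then 3 * δ κ else 0 := fun κ s μ => by
    split_ifs
    · exact mul_nonneg (by norm_num) (hδ' κ)
    · rfl
  -- Each edge is bounded by one term of a nonnegative sum over all charges, so overcounting, or
  -- pieces collapsing under the gluing, does no harm.
  calc _ ≤ ∑ μ : Vertex G hm, ∑ ν : Vertex G hm, ∑ κ : T, ∑ s : S,
        (if φ κ s = (μ, ν) then 3 * δ κ else 0) := by
        refine Finset.sum_le_sum fun μ _ => Finset.sum_le_sum fun ν _ => ?_
        have h0 : 0 ≤ ∑ κ : T, ∑ s : S, (if φ κ s = (μ, ν) then 3 * δ κ else 0) :=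
          Finset.sum_nonneg fun κ _ => Finset.sum_nonneg fun s _ => hterm κ s _
        split_ifs with hadj
        · rcases loss_adj τ hE hm hadj with h1 | ⟨a, b, x, y, h1, h2, s, h3⟩
          · rwa [h1]
          · have h4 : loss τ (vertexPVM τ hm hE μ) (vertexPVM τ hm hE ν)
                ≤ if φ (x, y, a, b) s = (μ, ν) then 3 * δ (x, y, a, b) else 0 := by
              rw [if_pos h3]
              simpa [δ, h1] using h2
            refine h4.trans ((Finset.single_le_sum (fun s _ => hterm (x, y, a, b) s (μ, ν))
              (Finset.mem_univ s)).trans ?_)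
            exact Finset.single_le_sum
              (f := fun κ => ∑ s : S, (if φ κ s = (μ, ν) then 3 * δ κ else 0))
              (fun κ _ => Finset.sum_nonneg fun s _ => hterm κ s (μ, ν)) (Finset.mem_univ _)
        · exact h0
    _ = ∑ κ : T, ∑ s : S, ∑ p : Vertex G hm × Vertex G hm,
          (if φ κ s = p then 3 * δ κ else 0) := by
        rw [← Fintype.sum_prod_type' fun μ ν => ∑ κ : T, ∑ s : S,
          (if φ κ s = (μ, ν) then 3 * δ κ else 0), Finset.sum_comm]
        exact Finset.sum_congr rfl fun κ _ => Finset.sum_comm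
    -- `243 = 81 * 3`: each tuple owns 81 labelled pairs, each charged `3 τ(ef)`.
    _ = 243 * ∑ κ : T, δ κ := by
        simp only [Finset.sum_ite_eq, Finset.mem_univ, if_true, Finset.sum_const, Finset.mul_sum]
        refine Finset.sum_congr rfl fun κ _ => ?_
        simp [S]
        ring
    _ = _ := by simp only [T, Fintype.sum_prod_type, δ]

end Colouring

/-! ### Winning probabilities -/

section WinProb

variable {H : Type u} [NormedAddCommGroup H] [InnerProductSpace ℂ H] [CompleteSpace H]
  {M : VonNeumannAlgebra H} (τ : FaithfulNormalTrace M)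

lemma sum_reTr_mul_eq_one {O : Type*} [Fintype O] {P Q : O → M.toStarSubalgebra}
    (hP : IsPVM M P) (hQ : IsPVM M Q) : ∑ a, ∑ b, τ.reTr (P a * Q b) = 1 := by
  simp only [← τ.reTr_sum, ← Finset.mul_sum, hQ.sum_eq_one, mul_one, hP.sum_eq_one, τ.reTr_one]

open Classical in
/-- The losing probability for the uniform distribution. -/
lemma sum_losing_eq {n m : ℕ} (G : SyncGame (Fin n) (Fin m))
    {E : Fin m → Fin n → M.toStarSubalgebra} (hE : ∀ x, IsPVM M fun a => E a x)
    {p : Correlation (Fin n) (Fin m)} (hp : ∀ a b x y, p a b x y = τ.reTr (E a x * E b y))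
    {ε : ℝ} (hε : G.winProb (uniformPrior (Fin n)) p = 1 - ε) :
    ∑ x, ∑ y, ∑ a, ∑ b, (if G.rule a b x y then 0 else τ.reTr (E a x * E b y))
      = (n : ℝ) ^ 2 * ε := by
  rcases Nat.eq_zero_or_pos n with rfl | hn
  · simp
  have hn' : (n : ℝ) ^ 2 ≠ 0 := by positivity
  have h1 : ∀ x y, ∑ a, ∑ b, (if G.rule a b x y then 0 else τ.reTr (E a x * E b y))
      = 1 - ∑ a, ∑ b, (if G.rule a b x y then (1 : ℝ) else 0) * p a b x y := fun x y => by
    refine Eq.trans ?_ (congrArg (· - _) (sum_reTr_mul_eq_one τ (hE x) (hE y)))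
    rw [← Finset.sum_sub_distrib]
    refine Finset.sum_congr rfl fun a _ => ?_
    rw [← Finset.sum_sub_distrib]
    refine Finset.sum_congr rfl fun b _ => ?_
    rw [hp]
    split_ifs <;> simp
  simp only [h1, Finset.sum_sub_distrib, Finset.sum_const, Finset.card_univ, Fintype.card_fin,
    nsmul_eq_mul, mul_one]
  simp only [SyncGame.winProb, uniformPrior, ← Finset.mul_sum, Fintype.card_fin] at hε
  rw [one_div, inv_mul_eq_iff_eq_mul₀ hn'] at hε
  rw [hε]
  ring

open Classical in
lemma sum_adj_eq {V : Type*} [Fintype V] (Γ : SimpleGraph V) :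
    ∑ μ, ∑ ν, (if Γ.Adj μ ν then (1 : ℝ) else 0) = 2 * numEdges Γ := by
  have h := congrArg (Nat.cast (R := ℝ)) Γ.sum_degrees_eq_twice_card_edges
  push_cast at h
  rw [numEdges, ← Γ.coe_edgeFinset, Set.ncard_coe_finset, ← h]
  refine Finset.sum_congr rfl fun μ _ => ?_
  rw [← Γ.card_neighborFinset_eq_degree, Γ.neighborFinset_eq_filter, Finset.sum_boole]

open Classical in
/-- The winning probability in the colouring game in terms of the losses on the edges. -/
lemma winProb_coloringGame {V : Type*} [Fintype V] (Γ : SimpleGraph V) (hΓ : numEdges Γ ≠ 0)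
    {P : V → Fin 3 → M.toStarSubalgebra} (hP : ∀ μ, IsPVM M (P μ)) :
    (coloringGame Γ).winProb (edgePrior Γ) (fun c d μ ν => τ.reTr (P μ c * P ν d))
      = 1 - (∑ μ, ∑ ν, if Γ.Adj μ ν then loss τ (P μ) (P ν) else 0) / (2 * numEdges Γ) := by
  have hN : (2 * numEdges Γ : ℝ) ≠ 0 := by positivity
  rw [eq_sub_iff_add_eq, ← div_self hN, ← sum_adj_eq Γ, SyncGame.winProb, Finset.sum_div,
    Finset.sum_div, ← Finset.sum_add_distrib]
  refine Finset.sum_congr rfl fun μ _ => ?_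
  rw [Finset.sum_div, Finset.sum_div, ← Finset.sum_add_distrib]
  refine Finset.sum_congr rfl fun ν _ => ?_
  by_cases h : Γ.Adj μ ν
  · have h1 : ∑ c, ∑ d, (if (coloringGame Γ).rule c d μ ν then (1 : ℝ) else 0)
        * τ.reTr (P μ c * P ν d) = 1 - loss τ (P μ) (P ν) := by
      refine Eq.trans ?_ (congrArg (· - _) (sum_reTr_mul_eq_one τ (hP μ) (hP ν)))
      -- Adjacent vertices are distinct, so the players lose exactly when the colours agree.
      rw [loss, ← Finset.sum_sub_distrib]
      refine Finset.sum_congr rfl fun c _ => ?_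
      simp only [coloringGame, h, h.ne, true_and, false_and, not_false_eq_true, ite_not, ite_mul,
        zero_mul, one_mul]
      rw [eq_sub_iff_add_eq, ← Finset.sum_erase_add _ _ (Finset.mem_univ c),
        ← Finset.sum_erase_add _ (fun d => τ.reTr (P μ c * P ν d)) (Finset.mem_univ c)]
      rw [if_pos rfl, add_zero]
      congr 1
      exact Finset.sum_congr rfl fun d hd => if_neg (Finset.ne_of_mem_erase hd).symm
    rw [h1, edgePrior, if_pos h, if_pos h, if_pos h, sum_adj_eq]
    ring
  · simp [edgePrior, h]

variable {n m : ℕ} (G : SyncGame (Fin n) (Fin m)) (hm : 3 ≤ m)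

/-- A projection-valued strategy for `G` gives one for the colouring game of `G_λ`. -/
lemma exists_coloring_correlation {p : Correlation (Fin n) (Fin m)} (hp : RealizedIn M τ p)
    {ε : ℝ} (hε : G.winProb (uniformPrior (Fin n)) p = 1 - ε) :
    ∃ p' : Correlation (Vertex G hm) (Fin 3), RealizedIn M τ p' ∧
      1 - 356 * (n : ℝ) ^ 2 * ε ≤ 1 - 356 * (n : ℝ) ^ 2 / (numEdges (gameGraph G hm) : ℝ) * ε ∧
      1 - 356 * (n : ℝ) ^ 2 / (numEdges (gameGraph G hm) : ℝ) * ε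
        ≤ (coloringGame (gameGraph G hm)).winProb (edgePrior (gameGraph G hm)) p' := by
  classical
  obtain ⟨E, hE, hpE⟩ := hp
  have hpE' : ∀ a b x y, p a b x y = τ.reTr (E a x * E b y) := fun a b x y => by
    rw [FaithfulNormalTrace.reTr, ← hpE, Complex.ofReal_re]
  have hP := isPVM_vertexPVM (G := G) τ hm hE
  have hone : (1 : M.toStarSubalgebra) ≠ 0 := fun h => by
    simpa [h] using τ.reTr_one
  -- `A` and `B` stay distinct after gluing because the assigned measures, which descend to the
  -- quotient, separate them. Hence there is at least one edge, and dividing by the number of edges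
  -- is harmless.
  have hAB : (gameGraph G hm).Adj (Quot.mk _ .A) (Quot.mk _ .B) := by
    refine (SimpleGraph.fromRel_adj _ _ _).2 ⟨fun h => hone ?_, Or.inl ⟨_, _, .AB, rfl, rfl⟩⟩
    exact congrFun (congrArg (vertexPVM τ hm hE) h) 0
  have hN : 1 ≤ numEdges (gameGraph G hm) :=
    (Set.ncard_pos (Set.toFinite _)).2 ⟨s(_, _), hAB⟩
  have hN' : (1 : ℝ) ≤ numEdges (gameGraph G hm) := by exact_mod_cast hN
  have hD := sum_losing_eq τ G hE hpE' hε
  have hD0 : 0 ≤ (n : ℝ) ^ 2 * ε := by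
    rw [← hD]
    refine Finset.sum_nonneg fun x _ => Finset.sum_nonneg fun y _ => Finset.sum_nonneg fun a _ =>
      Finset.sum_nonneg fun b _ => ?_
    split_ifs
    · rfl
    · exact τ.reTr_mul_nonneg ((hE x).proj a) ((hE y).proj b)
  have hL := sum_loss_le (G := G) τ hE hm
  rw [hD] at hL
  have hc : 356 * (n : ℝ) ^ 2 / (numEdges (gameGraph G hm) : ℝ) * ε
      = 356 * ((n : ℝ) ^ 2 * ε) / (numEdges (gameGraph G hm) : ℝ) := by ring
  refine ⟨fun c d μ ν => τ.reTr (vertexPVM τ hm hE μ c * vertexPVM τ hm hE ν d),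
    ⟨fun c μ => vertexPVM τ hm hE μ c, hP,
      fun c d μ ν => τ.ofReal_reTr_mul ((hP μ).proj c) ((hP ν).proj d)⟩, ?_, ?_⟩
  · rw [hc]
    have := div_le_self (by positivity : 0 ≤ 356 * ((n : ℝ) ^ 2 * ε)) hN'
    linarith
  · rw [winProb_coloringGame τ _ (by omega) hP, hc]
    refine sub_le_sub_left ?_ 1
    -- The bound obtained is `243/2` times `n² ε / |E|`, so 356 leaves ample room.
    rw [div_le_div_iff₀ (by positivity) (by positivity)]
    nlinarith

end WinProb

/-- The supremum need not be attained, so a correlation within `δ` of it is transported. The loss is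
scaled by `c`, and `δ` is then sent to 0 in the form of a contradiction. -/
lemma le_syncValue_of_forall {t : Model} {I O I' O' : Type*} [Fintype I] [Fintype O] [Fintype I']
    [Fintype O'] {G : SyncGame I O} {π : I → I → ℝ} {G' : SyncGame I' O'} {π' : I' → I' → ℝ}
    {c : ℝ} (hc : 0 ≤ c)
    (h : ∀ p ∈ syncCorr.{u} t I O, ∃ p' ∈ syncCorr.{u} t I' O',
      1 - c * (1 - G.winProb π p) ≤ G'.winProb π' p')
    {ε : ℝ} (hε : ((1 - ε : ℝ) : EReal) ≤ syncValue.{u} t G π) :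
    ((1 - c * ε : ℝ) : EReal) ≤ syncValue.{u} t G' π' := by
  by_contra! hlt
  obtain ⟨r, hr1, hr2⟩ := EReal.lt_iff_exists_real_btwn.1 hlt
  have hr2 : r < 1 - c * ε := EReal.coe_lt_coe_iff.1 hr2
  -- Chosen so that `1 - c(ε + δ) = r + δ > r`; the denominator `c + 1` also covers `c = 0`.
  obtain ⟨δ, hδ⟩ : ∃ δ, δ = (1 - c * ε - r) / (c + 1) := ⟨_, rfl⟩
  have hδ0 : 0 < δ := by rw [hδ]; exact div_pos (by linarith) (by linarith)
  have hδ1 : δ * (c + 1) = 1 - c * ε - r := by rw [hδ]; field_simp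
  have h1 : ((1 - ε - δ : ℝ) : EReal) < syncValue.{u} t G π :=
    lt_of_lt_of_le (EReal.coe_lt_coe_iff.2 (by linarith)) hε
  obtain ⟨p, h2⟩ := lt_iSup_iff.1 h1
  obtain ⟨hp, h3⟩ := lt_iSup_iff.1 h2
  have h3 : 1 - ε - δ < G.winProb π p := EReal.coe_lt_coe_iff.1 h3
  obtain ⟨p', hp', h4⟩ := h p hp
  have h5 : (G'.winProb π' p' : EReal) ≤ syncValue.{u} t G' π' :=
    le_iSup₂ (f := fun p (_ : p ∈ syncCorr.{u} t I' O') => (G'.winProb π' p : EReal)) p' hp'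
  have h6 : G'.winProb π' p' < r := EReal.coe_lt_coe_iff.1 (h5.trans_lt hr1)
  nlinarith [mul_le_mul_of_nonneg_left h3.le hc]

end SyncGames

end

open SyncGames in
theorem mainTheorem2 :
    ∃ P : MvPolynomial (Fin 2) ℝ,
      ∀ (n m : ℕ) (hm : 3 ≤ m) (G : SyncGame (Fin n) (Fin m)) (t : Model),
        (∀ (H : Type u) [NormedAddCommGroup H] [InnerProductSpace ℂ H] [CompleteSpace H]
          (M : VonNeumannAlgebra H) (τ : FaithfulNormalTrace M), t.Admits M τ →
          ∀ p : Correlation (Fin n) (Fin m), RealizedIn M τ p →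
          ∀ ε : ℝ, G.winProb (uniformPrior (Fin n)) p = 1 - ε →
            ∃ p' ∈ syncCorr.{u} t (Vertex G hm) (Fin 3), RealizedIn M τ p' ∧
              1 - MvPolynomial.eval ![(n : ℝ), (m : ℝ)] P * ε
                ≤ 1 - 356 * (n : ℝ) ^ 2 / (numEdges (gameGraph G hm) : ℝ) * ε ∧
              1 - 356 * (n : ℝ) ^ 2 / (numEdges (gameGraph G hm) : ℝ) * ε
                ≤ (coloringGame (gameGraph G hm)).winProb (edgePrior (gameGraph G hm)) p') ∧
        (∀ ε : ℝ, ((1 - ε : ℝ) : EReal) ≤ syncValue.{u} t G (uniformPrior (Fin n)) →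
          ((1 - MvPolynomial.eval ![(n : ℝ), (m : ℝ)] P * ε : ℝ) : EReal)
              ≤ syncValue.{u} t (coloringGame (gameGraph G hm)) (edgePrior (gameGraph G hm)) ∧
          ((1 - 356 * (n : ℝ) ^ 2 / (numEdges (gameGraph G hm) : ℝ) * ε : ℝ) : EReal)
              ≤ syncValue.{u} t (coloringGame (gameGraph G hm)) (edgePrior (gameGraph G hm))) := by
  -- Because `|E| ≥ 1`, the polynomial `356 n²` suffices, independently of `m`.
  refine ⟨MvPolynomial.C 356 * MvPolynomial.X 0 ^ 2, fun n m hm G t => ?_⟩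
  have hP : MvPolynomial.eval ![(n : ℝ), (m : ℝ)] (MvPolynomial.C 356 * MvPolynomial.X 0 ^ 2)
      = 356 * (n : ℝ) ^ 2 := by simp
  rw [hP]
  constructor
  · intro H _ _ _ M τ ht p hp ε hε
    obtain ⟨p', h1, h2, h3⟩ := exists_coloring_correlation τ G hm hp hε
    exact ⟨p', ⟨H, _, _, _, M, τ, ht, h1⟩, h1, h2, h3⟩
  · refine fun ε hε => ⟨le_syncValue_of_forall (by positivity) ?_ hε,
      le_syncValue_of_forall (by positivity) ?_ hε⟩ <;>
    · rintro p ⟨H, _, _, _, M, τ, ht, hp⟩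
      obtain ⟨p', h1, h2, h3⟩ := exists_coloring_correlation τ G hm hp (sub_sub_cancel _ _).symm
      refine ⟨p', ⟨H, _, _, _, M, τ, ht, h1⟩, ?_⟩
      first | exact h3 | exact h2.trans h3
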